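/- Let $\mathbb{H}$ be the real quaternions and, for $n \ge 1$, let $\mathrm{Sp}(n)=\{g\in \mathrm{GL}(n,\mathbb{H}) : {}^{t}\bar{g}\,g=I_n\}$ be the compact symplectic group. An involution of a group is an element $x \neq 1$ with $x^2=1$. Let $n>1$ and $g\in \mathrm{Sp}(n)$. If $n$ is even, then $g$ is a product of four involutions of $\mathrm{Sp}(n)$. If $n$ is odd, then $g$ is a product of five involutions of $\mathrm{Sp}(n)$. -/

import Mathlib

open scoped Quaternion

/-- The compact symplectic group `Sp(n)`: the quaternionic `n × n` matrices `g` with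
`star g * g = 1` and `g * star g = 1`, where `star g` is the conjugate transpose of `g`.
For `g` in `GL(n, ℍ)` each of the two equations implies the other. -/
noncomputable abbrev CompactSp (n : ℕ) : Submonoid (Matrix (Fin n) (Fin n) ℍ[ℝ]) :=
  unitary (Matrix (Fin n) (Fin n) ℍ[ℝ])

/-- An involution of a group is a non-trivial element whose square is the identity. -/
def IsGroupInvolution {G : Type*} [Group G] (x : G) : Prop :=
  x ≠ 1 ∧ x ^ 2 = 1

open Matrix MulOpposite

section
variable {ι : Type*} [Fintype ι] [DecidableEq ι]

/-! Every element of Sp(n) is conjugate to a diagonal matrix with unit complex entries `z i`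
(`exists_conj_eq_diagonal`). Let `σ` be an involutive permutation of the indices and choose `s i`
with `s i ^ 2 = z i * z (σ i)`, constant on `σ`-orbits. Then `z = s * t` with `t i * t (σ i) = 1`,
and such a `diagonal t` is a product of two monomial involutions. Since the quaternion `j`
conjugates `s` to its complex conjugate, which is its inverse, `diagonal s` is conjugate to a
diagonal of the same kind, hence also a product of two involutions. This gives four. A fixed point
of `σ` obstructs this unless its entry is ±1. For odd n there is one fixed point, and a fifth
involution is spent on creating an eigenvector of eigenvalue ±1 to place there
(`exists_involution_mul_eigenvector`). -/

theorem IsGroupInvolution.conj {G : Type*} [Group G] {x : G} (hx : IsGroupInvolution x) (p : G) :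
    IsGroupInvolution (p * x * p⁻¹) := by
  refine ⟨fun h => hx.1 ?_, ?_⟩
  · simpa using conj_eq_one_iff.1 h
  · rw [conj_pow, hx.2, mul_one, mul_inv_cancel]

/-! ### Quaternionic Householder reflections -/

omit [DecidableEq ι] in
theorem star_dotProduct_self_eq_normSq (v : ι → ℍ[ℝ]) :
    star v ⬝ᵥ v = ((∑ i, Quaternion.normSq (v i) : ℝ) : ℍ[ℝ]) := by
  simp only [dotProduct, Pi.star_apply, Quaternion.star_mul_self]
  exact (map_sum (algebraMap ℝ ℍ[ℝ]) _ _).symm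

omit [DecidableEq ι] in
theorem sum_normSq_ne_zero {v : ι → ℍ[ℝ]} (hv : v ≠ 0) :
    (∑ i, Quaternion.normSq (v i)) ≠ 0 := by
  intro h
  apply hv
  rw [Finset.sum_eq_zero_iff_of_nonneg fun i _ => Quaternion.normSq_nonneg] at h
  ext1 i
  exact Quaternion.normSq_eq_zero.1 (h i (Finset.mem_univ i))

/-- The quaternionic Householder reflection along a nonzero vector. -/
theorem exists_reflection {x : ι → ℍ[ℝ]} (hx : x ≠ 0) :
    ∃ R : unitary (Matrix ι ι ℍ[ℝ]), IsGroupInvolution R ∧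
      (R : Matrix ι ι ℍ[ℝ]) *ᵥ x = -x ∧ ∀ y, (R : Matrix ι ι ℍ[ℝ]) *ᵥ y =
        y - op (((2 / ∑ i, Quaternion.normSq (x i) : ℝ) : ℍ[ℝ]) * (star x ⬝ᵥ y)) • x := by
  set N : ℝ := ∑ i, Quaternion.normSq (x i) with hN
  have hN0 : N ≠ 0 := sum_normSq_ne_zero hx
  set R : Matrix ι ι ℍ[ℝ] := 1 - (2 / N : ℝ) • vecMulVec x (star x) with hR
  have hstar : star R = R := by
    rw [hR, star_sub, star_one]
    congr 1
    ext1 i j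
    simp [star_apply, vecMulVec_apply, Quaternion.star_smul]
  have happ : ∀ y, R *ᵥ y = y - op (((2 / N : ℝ) : ℍ[ℝ]) * (star x ⬝ᵥ y)) • x := by
    intro y
    rw [hR, sub_mulVec, one_mulVec, smul_mulVec, vecMulVec_mulVec]
    congr 1
    ext1 i
    simp only [Pi.smul_apply, op_smul_eq_mul]
    rw [← mul_assoc, ← Quaternion.coe_commutes, mul_assoc, Quaternion.coe_mul_eq_smul]
  have hxx : star x ⬝ᵥ x = (N : ℍ[ℝ]) := star_dotProduct_self_eq_normSq x
  have hRx : R *ᵥ x = - x := by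
    rw [happ, hxx, ← Quaternion.coe_mul, div_mul_cancel₀ _ hN0]
    ext1 i
    simp only [Pi.sub_apply, Pi.smul_apply, op_smul_eq_mul, Pi.neg_apply]
    rw [show ((2 : ℝ) : ℍ[ℝ]) = 2 from rfl]
    noncomm_ring
  have hsq : R * R = 1 := by
    refine Matrix.ext_of_mulVec_single fun i => ?_
    rw [← mulVec_mulVec]
    nth_rw 2 [happ]
    rw [mulVec_sub, mulVec_smul, hRx, happ, one_mulVec, smul_neg]
    abel
  have hU : R ∈ unitary (Matrix ι ι ℍ[ℝ]) := by
    rw [Unitary.mem_iff, hstar]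
    exact ⟨hsq, hsq⟩
  refine ⟨⟨R, hU⟩, ⟨fun h => ?_, Subtype.ext (by simpa [sq] using hsq)⟩, hRx, happ⟩
  have h1 : R = 1 := congrArg Subtype.val h
  rw [h1, one_mulVec] at hRx
  have h2 : (2 : ℝ) • x = 0 := by
    rw [two_smul]
    nth_rw 2 [hRx]
    exact add_neg_cancel x
  exact hx ((smul_eq_zero.1 h2).resolve_left two_ne_zero)

/-- Reflect along `x = v - w`. Equal norms and a real inner product give `2⟨x, v⟩ = ⟨x, x⟩`, so `v`
is sent to `v - x = w`. Over ℍ the reality of the inner product is a genuine condition. -/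
theorem exists_involution_mulVec_eq {v w : ι → ℍ[ℝ]} (hne : v ≠ w)
    (hn : star v ⬝ᵥ v = star w ⬝ᵥ w) (hr : star v ⬝ᵥ w = star w ⬝ᵥ v) :
    ∃ R : unitary (Matrix ι ι ℍ[ℝ]), IsGroupInvolution R ∧
      (R : Matrix ι ι ℍ[ℝ]) *ᵥ v = w ∧
      ∀ y, star v ⬝ᵥ y = star w ⬝ᵥ y → (R : Matrix ι ι ℍ[ℝ]) *ᵥ y = y := by
  have hx : v - w ≠ 0 := sub_ne_zero.2 hne
  obtain ⟨R, hR, -, happ⟩ := exists_reflection hx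
  refine ⟨R, hR, ?_, fun y hy => ?_⟩
  · have hN0 := sum_normSq_ne_zero hx
    set N : ℝ := ∑ i, Quaternion.normSq ((v - w) i)
    have h2 : (2 : ℝ) • (star (v - w) ⬝ᵥ v) = (N : ℍ[ℝ]) := by
      rw [← star_dotProduct_self_eq_normSq, star_sub, sub_dotProduct, sub_dotProduct,
        dotProduct_sub, dotProduct_sub, ← hn, hr, two_smul]
      abel
    have h3 : ((2 / N : ℝ) : ℍ[ℝ]) * (star (v - w) ⬝ᵥ v) = 1 := by
      rw [Quaternion.coe_mul_eq_smul, div_eq_inv_mul, mul_smul, h2, ← Quaternion.coe_smul,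
        smul_eq_mul, inv_mul_cancel₀ hN0, Quaternion.coe_one]
    rw [happ, h3, op_one, one_smul, sub_sub_cancel]
  · rw [happ, star_sub, sub_dotProduct, hy, sub_self, mul_zero, op_zero, zero_smul, sub_zero]

theorem diagonal_mem_unitary {d : ι → ℍ[ℝ]} (h : ∀ i, Quaternion.normSq (d i) = 1) :
    diagonal d ∈ unitary (Matrix ι ι ℍ[ℝ]) := by
  rw [Unitary.mem_iff, star_eq_conjTranspose, diagonal_conjTranspose, diagonal_mul_diagonal,
    diagonal_mul_diagonal]
  simp [Quaternion.star_mul_self, Quaternion.self_mul_star, h]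

/-- A nonzero vector vanishing on `S` is, up to a real scalar, a column of a unitary matrix that
fixes the standard basis vectors indexed by `S`. -/
theorem exists_unitary_mulVec_single {S : Finset ι} {k : ι} (hk : k ∉ S) {v : ι → ℍ[ℝ]}
    (hv : v ≠ 0) (hS : ∀ i ∈ S, v i = 0) :
    ∃ P : unitary (Matrix ι ι ℍ[ℝ]), ∃ r : ℝ,
      (P : Matrix ι ι ℍ[ℝ]) *ᵥ Pi.single k 1 = op (r : ℍ[ℝ]) • v ∧
      ∀ i ∈ S, (P : Matrix ι ι ℍ[ℝ]) *ᵥ Pi.single i 1 = Pi.single i 1 := by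
  have hN0 := sum_normSq_ne_zero hv
  set N : ℝ := ∑ i, Quaternion.normSq (v i) with hN
  have hNpos : 0 < N := lt_of_le_of_ne (Finset.sum_nonneg fun i _ => Quaternion.normSq_nonneg)
    hN0.symm
  -- `μ` is the phase of `v k`. Removing it makes the inner product of `w` with the `k`-th basis
  -- vector real, as the reflection requires; `D` puts it back.
  obtain ⟨μ, hμ, ρ, hρ⟩ : ∃ μ : ℍ[ℝ], Quaternion.normSq μ = 1 ∧
      ∃ ρ : ℝ, v k * star μ = (ρ : ℍ[ℝ]) := by
    by_cases h : v k = 0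
    · exact ⟨1, by simp, 0, by simp [h]⟩
    · have hn : ‖v k‖ ≠ 0 := norm_ne_zero_iff.2 h
      refine ⟨(‖v k‖⁻¹ : ℝ) • v k, ?_, ‖v k‖, ?_⟩
      · rw [Quaternion.normSq_smul, Quaternion.normSq_eq_norm_mul_self]
        field_simp
      · rw [Quaternion.star_smul, mul_smul_comm, Quaternion.self_mul_star, ← Quaternion.coe_smul,
          Quaternion.normSq_eq_norm_mul_self, smul_eq_mul, ← mul_assoc,
          inv_mul_cancel₀ hn, one_mul]
  set r : ℝ := (Real.sqrt N)⁻¹ with hr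
  have hr2 : r * r * N = 1 := by
    rw [hr, ← mul_inv, Real.mul_self_sqrt hNpos.le, inv_mul_cancel₀ hN0]
  set w : ι → ℍ[ℝ] := op ((r : ℍ[ℝ]) * star μ) • v with hw
  set D : unitary (Matrix ι ι ℍ[ℝ]) := ⟨diagonal (Function.update 1 k μ),
    diagonal_mem_unitary fun i => by
      by_cases h : i = k
      · subst h; simpa
      · simp [h]⟩ with hD
  have hDk : (D : Matrix ι ι ℍ[ℝ]) *ᵥ Pi.single k 1 = op μ • Pi.single k 1 := by
    ext1 i
    by_cases h : i = k
    · subst h; simp [hD, mulVec_diagonal]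
    · simp [hD, mulVec_diagonal, h]
  have hDS : ∀ i ∈ S, (D : Matrix ι ι ℍ[ℝ]) *ᵥ Pi.single i 1 = Pi.single i 1 := by
    intro i hi
    have hik : i ≠ k := fun h => hk (h ▸ hi)
    ext1 j
    by_cases h : j = i
    · subst h; simp [hD, mulVec_diagonal, hik]
    · simp [hD, mulVec_diagonal, h]
  have hww : star w ⬝ᵥ w = 1 := by
    rw [star_dotProduct_self_eq_normSq]
    have : ∀ i, Quaternion.normSq (w i) = r * r * Quaternion.normSq (v i) := by
      intro i
      simp only [hw, Pi.smul_apply, op_smul_eq_mul, map_mul, Quaternion.normSq_star, hμ,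
        Quaternion.normSq_coe]
      ring
    simp_rw [this]
    rw [← Finset.mul_sum, ← hN, hr2, Quaternion.coe_one]
  have hwk : w k = ((ρ * r : ℝ) : ℍ[ℝ]) := by
    simp only [hw, Pi.smul_apply, op_smul_eq_mul]
    rw [← mul_assoc, ← Quaternion.coe_commutes, mul_assoc, hρ, ← Quaternion.coe_mul, mul_comm]
  have hwμ : op μ • w = op (r : ℍ[ℝ]) • v := by
    rw [hw, smul_smul, ← op_mul, mul_assoc, Quaternion.star_mul_self, hμ, Quaternion.coe_one,
      mul_one]
  have hwS : ∀ i ∈ S, w i = 0 := fun i hi => by simp [hw, hS i hi]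
  by_cases hwe : Pi.single k 1 = w
  · refine ⟨D, r, ?_, hDS⟩
    rw [hDk, hwe, hwμ]
  · obtain ⟨R, -, hRk, hRS⟩ := exists_involution_mulVec_eq hwe
      (by rw [hww]; simp)
      (by simpa [hwk] using Quaternion.coe_commutes ρ (r : ℍ[ℝ]))
    refine ⟨R * D, r, ?_, fun i hi => ?_⟩
    · rw [Submonoid.coe_mul, ← mulVec_mulVec, hDk, mulVec_smul, hRk, hwμ]
    · have hik : i ≠ k := fun h => hk (h ▸ hi)
      rw [Submonoid.coe_mul, ← mulVec_mulVec, hDS i hi]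
      apply hRS
      simp [hwS i hi, hik]

/-! ### Diagonalisation with complex entries -/

theorem unitary_inv_mulVec_mulVec (P : unitary (Matrix ι ι ℍ[ℝ])) (v : ι → ℍ[ℝ]) :
    ((P⁻¹ : unitary (Matrix ι ι ℍ[ℝ])) : Matrix ι ι ℍ[ℝ]) *ᵥ ((P : Matrix ι ι ℍ[ℝ]) *ᵥ v) = v := by
  rw [mulVec_mulVec, ← Submonoid.coe_mul, inv_mul_cancel, Submonoid.coe_one, one_mulVec]

theorem unitary_mulVec_inv_mulVec (P : unitary (Matrix ι ι ℍ[ℝ])) (v : ι → ℍ[ℝ]) :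
    (P : Matrix ι ι ℍ[ℝ]) *ᵥ (((P⁻¹ : unitary (Matrix ι ι ℍ[ℝ])) : Matrix ι ι ℍ[ℝ]) *ᵥ v) = v := by
  rw [mulVec_mulVec, ← Submonoid.coe_mul, mul_inv_cancel, Submonoid.coe_one, one_mulVec]

theorem star_unitary_mulVec_dotProduct (P : unitary (Matrix ι ι ℍ[ℝ])) (v w : ι → ℍ[ℝ]) :
    star ((P : Matrix ι ι ℍ[ℝ]) *ᵥ v) ⬝ᵥ ((P : Matrix ι ι ℍ[ℝ]) *ᵥ w) = star v ⬝ᵥ w := by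
  rw [star_mulVec, ← dotProduct_mulVec, mulVec_mulVec, ← star_eq_conjTranspose,
    Unitary.coe_star_mul_self, one_mulVec]

theorem exists_eigenvector_of_invariant (h : Matrix ι ι ℍ[ℝ]) {S : Finset ι} {k : ι} (hk : k ∉ S)
    (hinv : ∀ v : ι → ℍ[ℝ], (∀ i ∈ S, v i = 0) → ∀ i ∈ S, (h *ᵥ v) i = 0) :
    ∃ v : ι → ℍ[ℝ], v ≠ 0 ∧ (∀ i ∈ S, v i = 0) ∧ ∃ c : ℂ, h *ᵥ v = op (c : ℍ[ℝ]) • v := by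
  -- Matrices commute with right scalars, so ℂ acts on the right; `h` is then ℂ-linear on a nonzero
  -- finite-dimensional space and has an eigenvalue.
  let φ : ℂ →+* ℍ[ℝ]ᵐᵒᵖ := (Quaternion.ofComplex : ℂ →+* ℍ[ℝ]).toOpposite fun x y => by
    rw [commute_iff_eq, ← map_mul, ← map_mul, mul_comm]
  let : Module ℂ (ι → ℍ[ℝ]) := Module.compHom _ φ
  have hsmul : ∀ (c : ℂ) (v : ι → ℍ[ℝ]), c • v = op (c : ℍ[ℝ]) • v := fun _ _ => rfl
  let W : Submodule ℂ (ι → ℍ[ℝ]) :=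
    { carrier := {v | ∀ i ∈ S, v i = 0}
      add_mem' := fun {a b} ha hb i hi => by simp [ha i hi, hb i hi]
      zero_mem' := fun i _ => rfl
      smul_mem' := fun c v hv i hi => by simp [hsmul, hv i hi] }
  let f : W →ₗ[ℂ] W :=
    { toFun := fun v => ⟨h *ᵥ v.1, hinv v.1 v.2⟩
      map_add' := fun v w => Subtype.ext (mulVec_add h v.1 w.1)
      map_smul' := fun c v => Subtype.ext (mulVec_smul h (op (c : ℍ[ℝ])) v.1) }
  have : IsScalarTower ℝ ℂ (ι → ℍ[ℝ]) := ⟨fun r c v => by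
    ext1 i
    have h1 : ((r • c : ℂ) : ℍ[ℝ]) = (r : ℍ[ℝ]) * c := by ext <;> simp
    simp only [hsmul, Pi.smul_apply, op_smul_eq_mul, h1]
    rw [← Quaternion.coe_mul_eq_smul, ← mul_assoc, ← Quaternion.coe_commutes, mul_assoc]⟩
  have : Module.Finite ℝ ℍ[ℝ] := Module.Finite.of_basis (QuaternionAlgebra.basisOneIJK _ _ _)
  have : Module.Finite ℂ (ι → ℍ[ℝ]) := Module.Finite.of_restrictScalars_finite ℝ ℂ _
  have : Nontrivial W := ⟨⟨⟨Pi.single k 1, fun i hi => by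
    have : i ≠ k := fun h => hk (h ▸ hi)
    simp [this]⟩, 0, fun h => by simpa using congrFun (congrArg Subtype.val h) k⟩⟩
  obtain ⟨c, hc⟩ := Module.End.exists_eigenvalue f
  obtain ⟨v, hv⟩ := hc.exists_hasEigenvector
  exact ⟨v.1, fun h => hv.2 (Subtype.ext h), v.2, c, congrArg Subtype.val hv.apply_eq_smul⟩

/-- A quaternionic unitary matrix that is already diagonal on the basis vectors indexed by `S` can
be diagonalised with complex entries, keeping the entries indexed by `S`. -/
theorem exists_conj_eq_diagonal (S : Finset ι) (h : unitary (Matrix ι ι ℍ[ℝ])) (c : ι → ℂ)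
    (hc : ∀ i ∈ S, (h : Matrix ι ι ℍ[ℝ]) *ᵥ Pi.single i 1 = op (c i : ℍ[ℝ]) • Pi.single i 1) :
    ∃ P : unitary (Matrix ι ι ℍ[ℝ]), ∃ d : ι → ℂ,
      ((P⁻¹ * h * P : unitary (Matrix ι ι ℍ[ℝ])) : Matrix ι ι ℍ[ℝ]) =
        diagonal (fun i => (d i : ℍ[ℝ])) ∧ ∀ i ∈ S, d i = c i := by
  induction hm : Sᶜ.card generalizing S h c with
  | zero =>
    have hS : ∀ i, i ∈ S := by
      rw [Finset.card_eq_zero, Finset.compl_eq_empty_iff] at hm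
      simp [hm]
    refine ⟨1, c, ?_, fun _ _ => rfl⟩
    rw [inv_one, one_mul, mul_one]
    refine Matrix.ext_of_mulVec_single fun i => ?_
    rw [hc i (hS i)]
    ext1 j
    by_cases hj : j = i
    · subst hj; simp
    · simp [hj]
  | succ m ih =>
    obtain ⟨k, hk⟩ : Sᶜ.Nonempty := Finset.card_pos.1 (by omega)
    have hkS := Finset.mem_compl.1 hk
    obtain ⟨v, hv0, hvS, c₀, hv⟩ := exists_eigenvector_of_invariant (h : Matrix ι ι ℍ[ℝ]) hkS (by
      -- Unitarity preserves orthogonality to the eigenvectors already found; their eigenvalues are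
      -- nonzero because `h` is invertible.
      intro v hv i hi
      have h1 := star_unitary_mulVec_dotProduct h (Pi.single i 1) v
      rw [hc i hi] at h1
      have h2 : star (c i : ℍ[ℝ]) * ((h : Matrix ι ι ℍ[ℝ]) *ᵥ v) i = 0 := by
        simpa [hv i hi, ← Pi.single_smul] using h1
      refine (mul_eq_zero.1 h2).resolve_left fun h0 => ?_
      have h3 := unitary_inv_mulVec_mulVec h (Pi.single i 1)
      rw [hc i hi, star_eq_zero.1 h0, op_zero, zero_smul, mulVec_zero] at h3
      simpa using congrFun h3 i)
    obtain ⟨P, r, hPk, hPS⟩ := exists_unitary_mulVec_single hkS hv0 hvS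
    have hP' : ∀ i ∈ S, ((P⁻¹ : unitary (Matrix ι ι ℍ[ℝ])) : Matrix ι ι ℍ[ℝ]) *ᵥ Pi.single i 1 =
        Pi.single i 1 := fun i hi => by
      nth_rw 1 [← hPS i hi]
      exact unitary_inv_mulVec_mulVec P _
    obtain ⟨Q, d, hQ, hd⟩ := ih (insert k S) (P⁻¹ * h * P) (Function.update c k c₀) (by
      intro i hi
      rw [Submonoid.coe_mul, Submonoid.coe_mul, ← mulVec_mulVec, ← mulVec_mulVec]
      by_cases hik : i = k
      · subst hik
        -- The scalar `r` is real, hence central, so rescaling `v` does not conjugate its eigenvalue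
        -- `c₀`.
        rw [Function.update_self, hPk, mulVec_smul, hv, smul_smul, ← op_mul,
          ← Quaternion.coe_commutes, op_mul, ← smul_smul, ← hPk, mulVec_smul,
          unitary_inv_mulVec_mulVec]
      · have hi' := Finset.mem_of_mem_insert_of_ne hi hik
        rw [hPS i hi', hc i hi', mulVec_smul, hP' i hi', Function.update_of_ne hik])
      (by
        rw [Finset.compl_insert, Finset.card_erase_of_mem hk, hm, Nat.add_sub_cancel])
    refine ⟨P * Q, d, ?_, fun i hi => ?_⟩
    · rw [← hQ]
      congr 1
      group
    · have hik : i ≠ k := fun h => hkS (h ▸ hi)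
      rw [hd i (Finset.mem_insert_of_mem hi), Function.update_of_ne hik]

/-! ### Diagonal matrices as products of monomial involutions -/

theorem exists_monomial_involution {σ : ι → ι} (hσ : Function.Involutive σ) (hne : ∃ i, σ i ≠ i)
    {t : ι → ℍ[ℝ]} (ht : ∀ i, Quaternion.normSq (t i) = 1) (hts : ∀ i, t i * t (σ i) = 1) :
    ∃ M : unitary (Matrix ι ι ℍ[ℝ]), IsGroupInvolution M ∧
      ∀ v i, ((M : Matrix ι ι ℍ[ℝ]) *ᵥ v) i = t i * v (σ i) := by
  set M : Matrix ι ι ℍ[ℝ] := of fun i j => if σ i = j then t i else 0 with hM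
  have happ : ∀ v i, (M *ᵥ v) i = t i * v (σ i) := fun v i => by
    simp [hM, mulVec, dotProduct]
  have hsq : M * M = 1 := by
    refine Matrix.ext_of_mulVec_single fun i => ?_
    ext1 j
    rw [← mulVec_mulVec, happ, happ, hσ j, ← mul_assoc, hts, one_mul, one_mulVec]
  have hstar : star M = M := by
    ext1 i j
    rw [star_apply, hM, of_apply, of_apply]
    by_cases h : σ i = j
    · subst h
      rw [if_pos (hσ i), if_pos rfl]
      calc star (t (σ i)) = t i * t (σ i) * star (t (σ i)) := by rw [hts, one_mul]
        _ = t i := by rw [mul_assoc, Quaternion.self_mul_star, ht, Quaternion.coe_one, mul_one]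
    · have h' : σ j ≠ i := fun h' => h (h' ▸ hσ j)
      rw [if_neg h, if_neg h', star_zero]
  have hU : M ∈ unitary (Matrix ι ι ℍ[ℝ]) := by
    rw [Unitary.mem_iff, hstar]
    exact ⟨hsq, hsq⟩
  refine ⟨⟨M, hU⟩, ⟨fun h => ?_, Subtype.ext (by simpa [sq] using hsq)⟩, happ⟩
  have h1 : M = 1 := congrArg Subtype.val h
  obtain ⟨i, hi⟩ := hne
  have h2 := happ (Pi.single i 1) i
  rw [h1, one_mulVec, Pi.single_eq_same, Pi.single_eq_of_ne hi, mul_zero] at h2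
  exact one_ne_zero h2

/-- The factors are the permutation matrix of `σ` with weights `t` and the one with weights 1; the
permutations cancel. -/
theorem diagonal_eq_mul_of_mul_eq_one {σ : ι → ι} (hσ : Function.Involutive σ)
    (hne : ∃ i, σ i ≠ i) {D : unitary (Matrix ι ι ℍ[ℝ])} {t : ι → ℍ[ℝ]}
    (hD : (D : Matrix ι ι ℍ[ℝ]) = diagonal t)
    (ht : ∀ i, Quaternion.normSq (t i) = 1) (hts : ∀ i, t i * t (σ i) = 1) :
    ∃ a b : unitary (Matrix ι ι ℍ[ℝ]), IsGroupInvolution a ∧ IsGroupInvolution b ∧ D = a * b := by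
  obtain ⟨a, ha, ha'⟩ := exists_monomial_involution hσ hne ht hts
  obtain ⟨b, hb, hb'⟩ := exists_monomial_involution (t := fun _ => 1) hσ hne
    (fun _ => map_one _) (fun _ => one_mul 1)
  refine ⟨a, b, ha, hb, Subtype.ext (Matrix.ext_of_mulVec_single fun i => ?_)⟩
  ext1 j
  rw [Submonoid.coe_mul, ← mulVec_mulVec, ha', hb', hD, mulVec_diagonal, hσ j, one_mul]

theorem Quaternion.normSq_coeComplex (z : ℂ) :
    Quaternion.normSq (z : ℍ[ℝ]) = Complex.normSq z := by
  simp [Quaternion.normSq_def', Complex.normSq_apply, sq]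

theorem exists_quaternion_of_components (a b c d : ℝ) :
    ∃ q : ℍ[ℝ], q.re = a ∧ q.imI = b ∧ q.imJ = c ∧ q.imK = d :=
  ⟨⟨a, b, c, d⟩, rfl, rfl, rfl, rfl⟩

theorem exists_unit_quaternion_mul_eq_conj_mul :
    ∃ j : ℍ[ℝ], Quaternion.normSq j = 1 ∧
      ∀ w : ℂ, j * (w : ℍ[ℝ]) = ((starRingEnd ℂ w : ℂ) : ℍ[ℝ]) * j := by
  obtain ⟨j, h0, h1, h2, h3⟩ := exists_quaternion_of_components 0 0 1 0
  refine ⟨j, by simp [Quaternion.normSq_def', h0, h1, h2, h3], fun w => ?_⟩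
  ext <;> simp [h0, h1, h2, h3]

theorem exists_four_involutions_of_diagonal {ι : Type*} [Fintype ι] [LinearOrder ι]
    {σ : ι → ι} (hσ : Function.Involutive σ)
    (hne : ∃ i, σ i ≠ i) {D : unitary (Matrix ι ι ℍ[ℝ])} {z : ι → ℂ}
    (hD : (D : Matrix ι ι ℍ[ℝ]) = diagonal fun i => (z i : ℍ[ℝ]))
    (hfix : ∀ i, σ i = i → z i * z i = 1) :
    ∃ a b c d : unitary (Matrix ι ι ℍ[ℝ]), IsGroupInvolution a ∧ IsGroupInvolution b ∧
      IsGroupInvolution c ∧ IsGroupInvolution d ∧ D = a * b * c * d := by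
  have hz : ∀ i, Complex.normSq (z i) = 1 := by
    intro i
    have h := congrFun (congrFun (Unitary.coe_star_mul_self D) i) i
    rw [hD, star_eq_conjTranspose, diagonal_conjTranspose, diagonal_mul_diagonal,
      diagonal_apply_eq, one_apply_eq, Pi.star_apply, Quaternion.star_mul_self,
      Quaternion.normSq_coeComplex] at h
    exact Quaternion.coe_injective h
  -- A fixed choice of root depends only on `z i * z (σ i)`, so `s` agrees on `i` and `σ i`.
  choose sq hsq using fun w : ℂ => IsAlgClosed.exists_eq_mul_self w
  obtain ⟨s, hs, hsσ⟩ : ∃ s : ι → ℂ, (∀ i, s i * s i = z i * z (σ i)) ∧ ∀ i, s (σ i) = s i :=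
    ⟨fun i => sq (z i * z (σ i)), fun i => (hsq _).symm, fun i => by
      simp only [hσ i, mul_comm (z (σ i))]⟩
  have hsn : ∀ i, Complex.normSq (s i) = 1 := fun i => by
    have h := congrArg Complex.normSq (hs i)
    rw [map_mul, map_mul, hz, hz, one_mul] at h
    nlinarith [Complex.normSq_nonneg (s i)]
  have hs0 : ∀ i, s i ≠ 0 := fun i h => by simpa [h] using hsn i
  have hcs : ∀ i, s i * (starRingEnd ℂ) (s i) = 1 := fun i => by
    rw [Complex.mul_conj, hsn, Complex.ofReal_one]
  set t : ι → ℂ := fun i => z i / s i with ht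
  have htn : ∀ i, Complex.normSq (t i) = 1 := fun i => by simp [ht, hz, hsn]
  have htt : ∀ i, t i * t (σ i) = 1 := fun i => by
    simp only [ht, hsσ]
    rw [div_mul_div_comm, ← hs, div_self (mul_ne_zero (hs0 i) (hs0 i))]
  -- The order singles out one index in each 2-cycle; the entry at the other is conjugated, so the
  -- two multiply to 1. At a fixed point `hfix` gives this directly.
  set s' : ι → ℂ := fun i => if i ≤ σ i then s i else (starRingEnd ℂ) (s i) with hs'
  have hsn' : ∀ i, Complex.normSq (s' i) = 1 := fun i => by
    simp only [hs']
    split_ifs <;> simp [hsn]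
  have hss' : ∀ i, s' i * s' (σ i) = 1 := fun i => by
    simp only [hs', hσ i, hsσ]
    rcases lt_trichotomy i (σ i) with h | h | h
    · rw [if_pos h.le, if_neg h.not_ge, hcs]
    · rw [if_pos h.le, if_pos h.ge, hs, ← h, hfix i h.symm]
    · rw [if_neg h.not_ge, if_pos h.le, mul_comm, hcs]
  obtain ⟨j, hjn, hj⟩ := exists_unit_quaternion_mul_eq_conj_mul
  set q : ι → ℍ[ℝ] := fun i => if i ≤ σ i then 1 else j with hq
  have hqn : ∀ i, Quaternion.normSq (q i) = 1 := fun i => by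
    simp only [hq]
    split_ifs <;> simp [hjn]
  set Q : unitary (Matrix ι ι ℍ[ℝ]) := ⟨diagonal q, diagonal_mem_unitary hqn⟩ with hQ
  obtain ⟨a, b, ha, hb, hab⟩ := diagonal_eq_mul_of_mul_eq_one hσ hne
    (D := ⟨diagonal fun i => (s' i : ℍ[ℝ]), diagonal_mem_unitary fun i => by
      rw [Quaternion.normSq_coeComplex, hsn']⟩) rfl
    (fun i => by rw [Quaternion.normSq_coeComplex, hsn'])
    (fun i => by rw [← Quaternion.coeComplex_mul, hss', Quaternion.coeComplex_one])
  obtain ⟨c, d, hc, hd, hcd⟩ := diagonal_eq_mul_of_mul_eq_one hσ hne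
    (D := ⟨diagonal fun i => (t i : ℍ[ℝ]), diagonal_mem_unitary fun i => by
      rw [Quaternion.normSq_coeComplex, htn]⟩) rfl
    (fun i => by rw [Quaternion.normSq_coeComplex, htn])
    (fun i => by rw [← Quaternion.coeComplex_mul, htt, Quaternion.coeComplex_one])
  refine ⟨Q⁻¹ * a * Q⁻¹⁻¹, Q⁻¹ * b * Q⁻¹⁻¹, c, d, ha.conj _, hb.conj _, hc, hd, ?_⟩
  -- `Q` carries `j` exactly where `s` was conjugated, and `j * s = conj s * j`.
  have key : Q * D = (a * b) * Q * (c * d) := by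
    rw [← hab, ← hcd]
    apply Subtype.ext
    simp only [Submonoid.coe_mul, hQ, hD, diagonal_mul_diagonal]
    congr 1
    ext1 i
    have hzi : z i = s i * t i := (mul_div_cancel₀ _ (hs0 i)).symm
    simp only [hq, hs', hzi, Quaternion.coeComplex_mul]
    split_ifs
    · rw [one_mul, mul_one]
    · rw [← mul_assoc, hj]
  rw [eq_inv_mul_of_mul_eq key]
  group

/-! ### The fifth involution, for odd n -/

theorem exists_star_dotProduct_diagonal_mulVec_selfAdjoint (z : ι → ℂ) {a b : ι} (hab : a ≠ b) :
    ∃ v : ι → ℍ[ℝ], v ≠ 0 ∧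
      star (star v ⬝ᵥ (diagonal (fun i => (z i : ℍ[ℝ])) *ᵥ v)) =
        star v ⬝ᵥ (diagonal (fun i => (z i : ℍ[ℝ])) *ᵥ v) := by
  by_cases ha : (z a).im = 0
  · refine ⟨Pi.single a 1, by simp, ?_⟩
    ext <;> simp [ha]
  suffices ∃ x y : ℍ[ℝ], y ≠ 0 ∧ star (star x * (z a * x) + star y * (z b * y)) =
      star x * (z a * x) + star y * (z b * y) by
    obtain ⟨x, y, hy, hxy⟩ := this
    refine ⟨Pi.single a x + Pi.single b y, fun h => hy ?_, ?_⟩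
    · simpa [hab.symm] using congrFun h b
    · have : star (Pi.single a x + Pi.single b y : ι → ℍ[ℝ]) ⬝ᵥ
          (diagonal (fun i => (z i : ℍ[ℝ])) *ᵥ (Pi.single a x + Pi.single b y)) =
          star x * (z a * x) + star y * (z b * y) := by
        rw [star_add, ← Pi.single_star, ← Pi.single_star, add_dotProduct, single_dotProduct,
          single_dotProduct, mulVec_diagonal, mulVec_diagonal]
        simp [hab, hab.symm]
      rw [this, hxy]
  -- With weights `β` at `a` and `α` at `b`, the two imaginary parts have equal size. They cancel if
  -- the signs are opposite; otherwise a factor `j` at `b` conjugates `z b`.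
  have hα := Real.mul_self_sqrt (abs_nonneg (z a).im)
  have hβ := Real.mul_self_sqrt (abs_nonneg (z b).im)
  have hα0 : √|(z a).im| ≠ 0 := (Real.sqrt_pos.2 (abs_pos.2 ha)).ne'
  set α := √|(z a).im|
  set β := √|(z b).im|
  rcases le_total 0 ((z a).im * (z b).im) with h | h
  · have h' : β * β * (z a).im = α * α * (z b).im := by
      rw [hα, hβ]
      rcases le_total 0 (z a).im with h1 | h1 <;> rcases le_total 0 (z b).im with h2 | h2 <;>
        simp only [abs_of_nonneg, abs_of_nonpos, h1, h2] <;> nlinarith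
    obtain ⟨q, q0, q1, q2, q3⟩ := exists_quaternion_of_components 0 0 α 0
    refine ⟨(β : ℍ[ℝ]), q, fun h0 => hα0 (by simpa [h0] using q2.symm), ?_⟩
    ext <;> simp [q0, q1, q2, q3] <;> nlinarith
  · have h' : β * β * (z a).im = - (α * α * (z b).im) := by
      rw [hα, hβ]
      rcases le_total 0 (z a).im with h1 | h1 <;> rcases le_total 0 (z b).im with h2 | h2 <;>
        simp only [abs_of_nonneg, abs_of_nonpos, h1, h2] <;> nlinarith
    refine ⟨(β : ℍ[ℝ]), (α : ℍ[ℝ]), fun h0 => hα0 (Quaternion.coe_injective h0), ?_⟩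
    ext <;> simp <;> nlinarith

/-- If `D w = v`, then `⟨v, w⟩` is real, so a reflection `k` takes `v` to `w` and `D k v = v`. If `v
= w`, the reflection along `v` gives `-v` instead. -/
theorem exists_involution_mul_eigenvector (D : unitary (Matrix ι ι ℍ[ℝ])) {v : ι → ℍ[ℝ]}
    (hv : v ≠ 0)
    (hr : star (star v ⬝ᵥ ((D : Matrix ι ι ℍ[ℝ]) *ᵥ v)) =
      star v ⬝ᵥ ((D : Matrix ι ι ℍ[ℝ]) *ᵥ v)) :
    ∃ k : unitary (Matrix ι ι ℍ[ℝ]), IsGroupInvolution k ∧ ∃ ε : ℂ, ε * ε = 1 ∧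
      ((D * k : unitary (Matrix ι ι ℍ[ℝ])) : Matrix ι ι ℍ[ℝ]) *ᵥ v = op (ε : ℍ[ℝ]) • v := by
  obtain ⟨w, hw⟩ : ∃ w, (D : Matrix ι ι ℍ[ℝ]) *ᵥ w = v := ⟨_, unitary_mulVec_inv_mulVec D v⟩
  by_cases hvw : v = w
  · obtain ⟨R, hR, hRv, -⟩ := exists_reflection hv
    refine ⟨R, hR, -1, by norm_num, ?_⟩
    have h1 : ((-1 : ℂ) : ℍ[ℝ]) = -1 := by ext <;> simp
    rw [Submonoid.coe_mul, ← mulVec_mulVec, hRv, mulVec_neg, h1, op_neg, op_one, neg_smul, one_smul]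
    nth_rw 1 [hvw]
    rw [hw]
  · have h1 := star_unitary_mulVec_dotProduct D w v
    have h2 := star_unitary_mulVec_dotProduct D v w
    rw [hw] at h1 h2
    obtain ⟨R, hR, hRv, -⟩ := exists_involution_mulVec_eq hvw
      (by rw [← star_unitary_mulVec_dotProduct D w w, hw])
      (by rw [← h1, ← h2, ← hr, star_dotProduct])
    refine ⟨R, hR, 1, one_mul 1, ?_⟩
    rw [Submonoid.coe_mul, ← mulVec_mulVec, hRv, hw, Quaternion.coeComplex_one, op_one, one_smul]

theorem exists_four_involutions {ι : Type*} [Fintype ι] [LinearOrder ι]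
    {σ : ι → ι} (hσ : Function.Involutive σ) (hne : ∃ i, σ i ≠ i)
    (S : Finset ι) (hS : ∀ i, σ i = i → i ∈ S) (h : unitary (Matrix ι ι ℍ[ℝ])) (c : ι → ℂ)
    (hc : ∀ i ∈ S, (h : Matrix ι ι ℍ[ℝ]) *ᵥ Pi.single i 1 = op (c i : ℍ[ℝ]) • Pi.single i 1)
    (hcc : ∀ i ∈ S, c i * c i = 1) :
    ∃ a b c d : unitary (Matrix ι ι ℍ[ℝ]), IsGroupInvolution a ∧ IsGroupInvolution b ∧
      IsGroupInvolution c ∧ IsGroupInvolution d ∧ h = a * b * c * d := by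
  obtain ⟨P, d, hP, hd⟩ := exists_conj_eq_diagonal S h c hc
  obtain ⟨x, y, z, w, hx, hy, hz, hw, he⟩ := exists_four_involutions_of_diagonal hσ hne hP
    fun i hi => by rw [hd i (hS i hi), hcc i (hS i hi)]
  refine ⟨P * x * P⁻¹, P * y * P⁻¹, P * z * P⁻¹, P * w * P⁻¹, hx.conj P, hy.conj P, hz.conj P,
    hw.conj P, ?_⟩
  calc h = P * (P⁻¹ * h * P) * P⁻¹ := by group
    _ = _ := by rw [he]; group

theorem exists_five_involutions {ι : Type*} [Fintype ι] [LinearOrder ι]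
    {σ : ι → ι} (hσ : Function.Involutive σ) {m a : ι} (ha : σ a ≠ a)
    (hm : ∀ i, σ i = i → i = m) (g : unitary (Matrix ι ι ℍ[ℝ])) :
    ∃ a b c d e : unitary (Matrix ι ι ℍ[ℝ]), IsGroupInvolution a ∧ IsGroupInvolution b ∧
      IsGroupInvolution c ∧ IsGroupInvolution d ∧ IsGroupInvolution e ∧
      g = a * b * c * d * e := by
  obtain ⟨P, d, hP, -⟩ := exists_conj_eq_diagonal ∅ g 0 (by simp)
  obtain ⟨v, hv, hr⟩ := exists_star_dotProduct_diagonal_mulVec_selfAdjoint d ha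
  rw [← hP] at hr
  obtain ⟨k, hk, ε, hε, hkv⟩ := exists_involution_mul_eigenvector _ hv hr
  -- `Q` moves the ±1-eigenvector to position `m`, the only possible fixed point of `σ`.
  obtain ⟨Q, r, hQ, -⟩ := exists_unitary_mulVec_single (Finset.notMem_empty m) hv (by simp)
  obtain ⟨x, y, z, w, hx, hy, hz, hw, he⟩ := exists_four_involutions hσ ⟨a, ha⟩ {m}
    (fun i hi => by simp [hm i hi]) (Q⁻¹ * (P⁻¹ * g * P * k) * Q) (fun _ => ε) (by
      intro i hi
      rw [Finset.mem_singleton.1 hi, Submonoid.coe_mul, Submonoid.coe_mul, ← mulVec_mulVec,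
        ← mulVec_mulVec, hQ, mulVec_smul, hkv, smul_smul, ← op_mul, ← Quaternion.coe_commutes,
        op_mul, ← smul_smul, ← hQ, mulVec_smul, unitary_inv_mulVec_mulVec])
    (fun _ _ => hε)
  refine ⟨_, _, _, _, _, hx.conj (P * Q), hy.conj (P * Q), hz.conj (P * Q), hw.conj (P * Q),
    hk.conj P, ?_⟩
  have hkk : k * k = 1 := by rw [← sq]; exact hk.2
  calc g = P * Q * (Q⁻¹ * (P⁻¹ * g * P * k) * Q) * Q⁻¹ * k * P⁻¹ := by
        have : P * Q * (Q⁻¹ * (P⁻¹ * g * P * k) * Q) * Q⁻¹ * k * P⁻¹ =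
          g * P * (k * k) * P⁻¹ := by group
        rw [this, hkk]
        group
    _ = _ := by rw [he]; group

end

theorem corollary1p3 (n : ℕ) (hn : 1 < n) (g : CompactSp n) :
    (Even n → ∃ a b c d : CompactSp n,
      IsGroupInvolution a ∧ IsGroupInvolution b ∧ IsGroupInvolution c ∧ IsGroupInvolution d ∧
        g = a * b * c * d) ∧
    (Odd n → ∃ a b c d e : CompactSp n,
      IsGroupInvolution a ∧ IsGroupInvolution b ∧ IsGroupInvolution c ∧ IsGroupInvolution d ∧
        IsGroupInvolution e ∧ g = a * b * c * d * e) := by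
  have h0 : Fin.rev (⟨0, by omega⟩ : Fin n) ≠ ⟨0, by omega⟩ := fun h => by
    have := congrArg Fin.val h
    rw [Fin.val_rev] at this
    dsimp only at this
    omega
  constructor
  · rintro ⟨m, hm⟩
    refine exists_four_involutions Fin.rev_involutive ⟨_, h0⟩ ∅ (fun i hi => ?_) g 0 (by simp)
      (by simp)
    have := congrArg Fin.val hi
    rw [Fin.val_rev] at this
    omega
  · rintro ⟨m, hm⟩
    refine exists_five_involutions Fin.rev_involutive (m := ⟨m, by omega⟩) h0 (fun i hi => ?_) g
    have := congrArg Fin.val hi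
    rw [Fin.val_rev] at this
    apply Fin.ext
    dsimp only
    omega
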